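/- Let $r,p\ge 1$ be integers, $m\in\mathbb R^{r\times p}$, $P$ a symmetric positive definite $r\times r$ matrix, $S$ a symmetric positive definite $p\times p$ matrix, $N=\mathrm{diag}(n_1,\dots,n_p)$ with all $n_i>0$, and $v\in\mathbb R$. Write $N^{1/2}=\mathrm{diag}(\sqrt{n_1},\dots,\sqrt{n_p})$. The matrix normal distribution $N_{r\times p}(m,P,\Sigma)$ is the law of a random $r\times p$ matrix $Y$ with $\mathrm{vec}(Y)\sim N_{rp}(\mathrm{vec}(m),\Sigma\otimes P)$, where $\mathrm{vec}$ stacks columns. The modified inverted Wishart distribution $MIW_p(S,N,v)$ is the probability law on the set of symmetric positive definite $p\times p$ matrices with density $$p(\Sigma)=c\,|\Sigma|^{-\{v+\mathrm{tr}(N)/(2p)\}}\exp\Bigl\{-\tfrac12\,\mathrm{tr}\bigl(N^{1/2}SN^{1/2}\Sigma^{-1}\bigr)\Bigr\}$$ with respect to Lebesgue measure in the $p(p+1)/2$ distinct entries of $\Sigma$, where $c$ is the normalizing constant (the parameters being such that this density is integrable). Let $Y$ be a random $r\times p$ matrix and $\Sigma$ a random $p\times p$ matrix on a common probability space such that $\Sigma\sim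 MIW_p(S,N,v)$ and the conditional distribution of $Y$ given $\Sigma$ is $N_{r\times p}(m,P,\Sigma)$. Put $N^*=N+rI_p$. Then for every $y\in\mathbb R^{r\times p}$ the equation $$N^{*1/2}S^*N^{*1/2}=(y-m)'P^{-1}(y-m)+N^{1/2}SN^{1/2}$$ has exactly one solution $S^*=S^*(y)$, this solution is symmetric positive definite, and the conditional distribution of $\Sigma$ given $Y$ is $MIW_p(S^*(Y),N^*,v)$, that is, for almost every $y$ with respect to the law of $Y$ the conditional distribution of $\Sigma$ given $Y=y$ is $MIW_p(S^*(y),N^*,v)$. -/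

import Mathlib

open MeasureTheory ProbabilityTheory
open scoped Kronecker

/-- The Borel (= product) σ-algebra on the space of real `r × p` matrices. -/
instance matrixMeasurableSpace (r p : ℕ) : MeasurableSpace (Matrix (Fin r) (Fin p) ℝ) :=
  inferInstanceAs (MeasurableSpace (Fin r → Fin p → ℝ))

instance matrixBorelSpace (r p : ℕ) : BorelSpace (Matrix (Fin r) (Fin p) ℝ) :=
  inferInstanceAs (BorelSpace (Fin r → Fin p → ℝ))

instance matrixStandardBorelSpace (r p : ℕ) :
    StandardBorelSpace (Matrix (Fin r) (Fin p) ℝ) :=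
  inferInstanceAs (StandardBorelSpace (Fin r → Fin p → ℝ))

/-- The matrix normal distribution `N_{r×p}(m, P, Σ)`: the law of the `r × p` matrix `Y` with
`vec Y ∼ N_{rp}(vec m, Σ ⊗ P)`, where `vec` is the column stacking operator. In Mathlib the
entries of `vec A` are indexed by pairs (column, row), that is, `vec A (j, i) = A i j`. -/
noncomputable def matrixNormal {r p : ℕ} (m : Matrix (Fin r) (Fin p) ℝ)
    (P : Matrix (Fin r) (Fin r) ℝ) (Sig : Matrix (Fin p) (Fin p) ℝ) :
    Measure (Matrix (Fin r) (Fin p) ℝ) :=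
  (multivariateGaussian (WithLp.toLp 2 (Matrix.vec m)) (Sig ⊗ₖ P)).map
    (fun x => Matrix.of fun i j => x (j, i))

/-- The symmetric `p × p` matrix with prescribed entries `x s(i, j)`, `i ≤ j`. -/
def symMatrix {p : ℕ} (x : Sym2 (Fin p) → ℝ) : Matrix (Fin p) (Fin p) ℝ :=
  Matrix.of fun i j => x s(i, j)

/-- The measure `dΣ`: Lebesgue measure in the `p (p + 1) / 2` distinct entries of a symmetric
`p × p` matrix. -/
noncomputable def symVolume (p : ℕ) : Measure (Matrix (Fin p) (Fin p) ℝ) :=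
  (volume : Measure (Sym2 (Fin p) → ℝ)).map symMatrix

/-- The square root `N^{1/2}` of a diagonal matrix `N` with nonnegative diagonal entries. -/
noncomputable def diagSqrt {p : ℕ} (N : Matrix (Fin p) (Fin p) ℝ) :
    Matrix (Fin p) (Fin p) ℝ :=
  Matrix.diagonal fun i => √(N i i)

/-- The function
`|Σ|^{-(v + tr(N)/(2p))} etr(-(1/2) N^{1/2} S N^{1/2} Σ⁻¹)` of a positive definite `Σ`. -/
noncomputable def miwWeight {p : ℕ} (S N : Matrix (Fin p) (Fin p) ℝ) (v : ℝ)
    (Sig : Matrix (Fin p) (Fin p) ℝ) : ℝ :=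
  Sig.det ^ (-(v + N.trace / (2 * (p : ℝ)))) *
    Real.exp (-(1 / 2) * (diagSqrt N * S * diagSqrt N * Sig⁻¹).trace)

/-- The measure with density `miwWeight` on the cone of positive definite matrices. -/
noncomputable def miwUnnormalized {p : ℕ} (S N : Matrix (Fin p) (Fin p) ℝ) (v : ℝ) :
    Measure (Matrix (Fin p) (Fin p) ℝ) :=
  ((symVolume p).restrict {Sig | Sig.PosDef}).withDensity
    fun Sig => ENNReal.ofReal (miwWeight S N v Sig)

/-- The modified inverted Wishart distribution `MIW_p(S, N, v)`: the law with density
`c * miwWeight S N v` on positive definite matrices, `c` being the normalizing constant. For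
parameters where the integral of `miwWeight` diverges this is the zero measure, so no random
matrix has this law. -/
noncomputable def miw {p : ℕ} (S N : Matrix (Fin p) (Fin p) ℝ) (v : ℝ) :
    Measure (Matrix (Fin p) (Fin p) ℝ) :=
  (miwUnnormalized S N v Set.univ)⁻¹ • miwUnnormalized S N v

/-! By Bayes' rule the posterior density is proportional to prior times likelihood. For positive
definite `Σ` and `P` the matrix normal density is a constant times `|Σ|^(-r/2) exp(-tr((y-m)' P⁻¹
(y-m) Σ⁻¹)/2)`. Multiplied by the MIW weight it gives a weight of the same shape: traces against
`Σ⁻¹` add, which produces `S*`, and `tr N* / (2p) = tr N / (2p) + r/2` absorbs the determinant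
power, so `v` is unchanged. The ingredients are the density `matrixNormal_eq_withDensity`, the
measure-theoretic Bayes rule `condDistrib_ae_eq_of_withDensity`, and the conjugacy identity
`miwWeight_mul_matrixNormalPDF`. -/

theorem MeasureTheory.Measure.map_withDensity_comp {α β : Type*} [MeasurableSpace α]
    [MeasurableSpace β] (μ : Measure α) {T : α → β} (hT : Measurable T) {g : β → ENNReal}
    (hg : Measurable g) :
    (μ.withDensity (g ∘ T)).map T = (μ.map T).withDensity g := by
  ext s hs
  rw [Measure.map_apply hT hs, withDensity_apply _ (hT hs), withDensity_apply _ hs,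
    Measure.restrict_map hT hs, lintegral_map hg hT]
  rfl

/-! ### Densities of Gaussian measures. -/

section gaussian

variable {E : Type*} [NormedAddCommGroup E] [InnerProductSpace ℝ E] [FiniteDimensional ℝ E]
  [MeasurableSpace E] [BorelSpace E]

/-- The standard Gaussian measure has density `(2π)^(-n/2) exp (-‖x‖² / 2)`. -/
theorem stdGaussian_eq_withDensity :
    stdGaussian E = (volume : Measure E).withDensity fun x =>
      ENNReal.ofReal (((2 * Real.pi) ^ (Module.finrank ℝ E / 2 : ℝ))⁻¹ *
        Real.exp (-(1 / 2) * ‖x‖ ^ 2)) := by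
  set n : ℝ := Module.finrank ℝ E / 2
  set c : ℝ := (2 * Real.pi) ^ n
  have hc : 0 < c := by positivity
  have hint : Integrable (fun x : E => c⁻¹ * Real.exp (-(1 / 2) * ‖x‖ ^ 2)) := by
    refine Integrable.const_mul ?_ _
    have h := GaussianFourier.integrable_cexp_neg_mul_sq_norm_add (V := E) (b := 1 / 2)
      (by norm_num) 0 0
    convert h.re using 2 with x
    rw [← Complex.ofReal_re (Real.exp _)]
    congr 1
    push_cast
    simp
  have hfin : IsFiniteMeasure ((volume : Measure E).withDensity fun x =>
      ENNReal.ofReal (c⁻¹ * Real.exp (-(1 / 2) * ‖x‖ ^ 2))) :=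
    isFiniteMeasure_withDensity_ofReal hint.2
  apply Measure.ext_of_charFun
  ext t
  rw [charFun_stdGaussian, charFun_apply,
    integral_withDensity_eq_integral_toReal_smul (by fun_prop) (by simp)]
  -- With `b = 1/2` the prefactor `(π/b)^(n/2)` is exactly `c`, and the coefficient `I` leaves `exp
  -- (-‖t‖²/2)`.
  have h := GaussianFourier.integral_cexp_neg_mul_sq_norm_add (V := E) (b := 1 / 2)
      (by norm_num) Complex.I t
  have h2 : ∀ x : E, (ENNReal.ofReal (c⁻¹ * Real.exp (-(1 / 2) * ‖x‖ ^ 2))).toReal •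
      Complex.exp (inner ℝ x t * Complex.I) = (c⁻¹ : ℂ) *
      Complex.exp (-(1 / 2) * ‖x‖ ^ 2 + Complex.I * inner ℝ t x) := by
    intro x
    rw [ENNReal.toReal_ofReal (by positivity), Complex.exp_add, Complex.real_smul,
      real_inner_comm]
    push_cast
    rw [mul_assoc, mul_comm (Complex.I)]
  simp_rw [h2]
  rw [integral_const_mul, h]
  have h3 : ((Real.pi : ℂ) / (1 / 2)) ^ (Module.finrank ℝ E / 2 : ℂ) = (c : ℂ) := by
    rw [Complex.ofReal_cpow (by positivity)]
    simp only [n]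
    push_cast
    congr 1
    ring
  rw [h3, ← mul_assoc, inv_mul_cancel₀ (by exact_mod_cast hc.ne'), one_mul]
  congr 1
  rw [Complex.I_sq]
  ring

end gaussian

open Matrix MatrixOrder in
/-- The density of a nondegenerate multivariate Gaussian measure. -/
theorem multivariateGaussian_eq_withDensity {ι : Type*} [Fintype ι] [DecidableEq ι]
    (m : EuclideanSpace ℝ ι) {S : Matrix ι ι ℝ} (hS : S.PosDef) :
    multivariateGaussian m S = (volume : Measure (EuclideanSpace ℝ ι)).withDensity fun x =>
      ENNReal.ofReal (((2 * Real.pi) ^ (Fintype.card ι / 2 : ℝ))⁻¹ * (√S.det)⁻¹ *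
        Real.exp (-(1 / 2) * ((x - m).ofLp ⬝ᵥ S⁻¹ *ᵥ (x - m).ofLp))) := by
  set A := CFC.sqrt S
  have hAA : A * A = S := CFC.sqrt_mul_sqrt_self S hS.posSemidef.nonneg
  have hA0 : A.PosSemidef := (CFC.sqrt_nonneg S).posSemidef
  have hAT : Aᵀ = A := (conjTranspose_eq_transpose_of_trivial A).symm.trans hA0.1
  have hdet : A.det = √S.det := by
    rw [← hAA, det_mul, Real.sqrt_mul_self hA0.det_nonneg]
  have hdetpos : 0 < A.det := hdet ▸ Real.sqrt_pos.2 hS.det_pos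
  set L : EuclideanSpace ℝ ι →L[ℝ] EuclideanSpace ℝ ι := toEuclideanCLM (𝕜 := ℝ) A
  have hLdet : LinearMap.det (L : EuclideanSpace ℝ ι →ₗ[ℝ] EuclideanSpace ℝ ι) = A.det := by
    rw [coe_toEuclideanCLM_eq_toEuclideanLin, toEuclideanLin, toLpLin_eq_toLin, LinearMap.det_toLin]
  have hvol : (volume : Measure (EuclideanSpace ℝ ι)).map (fun x => m + L x) =
      ENNReal.ofReal (√S.det)⁻¹ • volume := by
    have h := Measure.map_linearMap_addHaar_eq_smul_addHaar
      (volume : Measure (EuclideanSpace ℝ ι)) (f := (L : EuclideanSpace ℝ ι →ₗ[ℝ] _))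
      (by rw [hLdet]; exact hdetpos.ne')
    rw [hLdet, abs_of_pos (inv_pos.2 hdetpos), hdet] at h
    have h2 : (fun x => m + L x) = (fun x => m + x) ∘ (L : EuclideanSpace ℝ ι →ₗ[ℝ] _) := rfl
    rw [h2, ← Measure.map_map (by fun_prop) (by simp; fun_prop), h, Measure.map_smul,
      map_add_left_eq_self]
  -- The factor `(√S.det)⁻¹` is left out of `g`: it comes from the change of volume `hvol`.
  set g : EuclideanSpace ℝ ι → ENNReal := fun x =>
    ENNReal.ofReal (((2 * Real.pi) ^ (Fintype.card ι / 2 : ℝ))⁻¹ *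
        Real.exp (-(1 / 2) * ((x - m).ofLp ⬝ᵥ S⁻¹ *ᵥ (x - m).ofLp))) with hgdef
  have hg : Measurable g := by
    refine ENNReal.measurable_ofReal.comp (Continuous.measurable ?_)
    unfold dotProduct mulVec dotProduct
    fun_prop
  have hcomp : (fun x : EuclideanSpace ℝ ι =>
      ENNReal.ofReal (((2 * Real.pi) ^ (Module.finrank ℝ (EuclideanSpace ℝ ι) / 2 : ℝ))⁻¹ *
        Real.exp (-(1 / 2) * ‖x‖ ^ 2))) = g ∘ (fun x => m + L x) := by
    ext x
    simp only [hgdef, Function.comp, finrank_euclideanSpace, add_sub_cancel_left]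
    congr 4
    rw [EuclideanSpace.real_norm_sq_eq, ofLp_toEuclideanCLM, mulVec_mulVec, ← hAA, Matrix.mul_inv_rev,
      mul_assoc, nonsing_inv_mul _ (isUnit_iff_ne_zero.2 hdetpos.ne'), mul_one,
      dotProduct_mulVec, ← vecMul_transpose, hAT, vecMul_vecMul,
      mul_nonsing_inv _ (isUnit_iff_ne_zero.2 hdetpos.ne'), vecMul_one]
    simp [dotProduct, sq]
  rw [multivariateGaussian, stdGaussian_eq_withDensity, hcomp]
  change Measure.map (fun x => m + L x) _ = _
  rw [Measure.map_withDensity_comp _ (by fun_prop) hg, hvol,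
    withDensity_smul_measure, ← withDensity_smul _ hg]
  congr 1
  ext x
  simp only [hgdef, Pi.smul_apply, smul_eq_mul]
  rw [← ENNReal.ofReal_mul (by positivity)]
  congr 1
  ring

/-! ### Conditional laws from densities. -/

/-- **Bayes' rule** for densities. -/
theorem condDistrib_ae_eq_of_withDensity {Ω α β : Type*} [MeasurableSpace Ω]
    [MeasurableSpace α] [StandardBorelSpace α] [Nonempty α]
    [MeasurableSpace β] [StandardBorelSpace β] [Nonempty β]
    (μ : Measure Ω) [IsProbabilityMeasure μ] {Y : Ω → α} {X : Ω → β}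
    (hY : Measurable Y) (hX : Measurable X) (ν : Measure α) [SFinite ν] (τ : Measure β) [SFinite τ]
    {f : β → ENNReal} (hf : Measurable f) {g : β → α → ENNReal}
    (hg : Measurable (Function.uncurry g))
    (hXlaw : μ.map X = τ.withDensity f)
    (hcond : ∀ᵐ x ∂(μ.map X), condDistrib Y X μ x = ν.withDensity (g x)) :
    ∀ᵐ y ∂(μ.map Y), condDistrib X Y μ y =
      (∫⁻ x, f x * g x y ∂τ)⁻¹ • τ.withDensity fun x => f x * g x y := by
  -- `Z` is the density of the law of `Y` with respect to `ν`.
  set Z : α → ENNReal := fun y => ∫⁻ x, f x * g x y ∂τ with hZ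
  have hh : Measurable (Function.uncurry fun y x => f x * g x y) :=
    (hf.comp measurable_snd).mul (hg.comp measurable_swap)
  have hZm : Measurable Z := hh.lintegral_prod_right
  have hgx : ∀ x, Measurable (g x) := fun x => hg.of_uncurry_left
  have hhy : ∀ y, Measurable fun x => f x * g x y := fun y => hh.of_uncurry_left
  have joint : ∀ F : α × β → ENNReal, Measurable F →
      ∫⁻ z, F z ∂(μ.map fun ω => (Y ω, X ω)) = ∫⁻ y, ∫⁻ x, f x * g x y * F (y, x) ∂τ ∂ν := by
    intro F hF
    have h1 : ∫⁻ z, F z ∂(μ.map fun ω => (Y ω, X ω)) =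
        ∫⁻ z, F z.swap ∂(μ.map fun ω => (X ω, Y ω)) := by
      rw [lintegral_map hF (by fun_prop), lintegral_map (by fun_prop) (by fun_prop)]
      rfl
    rw [h1, ← compProd_map_condDistrib hY.aemeasurable, Measure.lintegral_compProd (by fun_prop)]
    have h2 : ∫⁻ x, ∫⁻ y, F (x, y).swap ∂(condDistrib Y X μ x) ∂(μ.map X) =
        ∫⁻ x, ∫⁻ y, g x y * F (y, x) ∂ν ∂(μ.map X) := by
      refine lintegral_congr_ae ?_
      filter_upwards [hcond] with x hx
      rw [hx, lintegral_withDensity_eq_lintegral_mul _ (hgx x) (by fun_prop)]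
      rfl
    have hm : Measurable (Function.uncurry fun x y => g x y * F (y, x)) :=
      hg.mul (hF.comp measurable_swap)
    rw [h2, hXlaw, lintegral_withDensity_eq_lintegral_mul _ hf hm.lintegral_prod_right]
    simp only [Pi.mul_apply]
    have h3 : ∀ x, f x * ∫⁻ y, g x y * F (y, x) ∂ν = ∫⁻ y, f x * g x y * F (y, x) ∂ν := by
      intro x
      rw [← lintegral_const_mul _ hm.of_uncurry_left]
      simp only [mul_assoc]
    simp_rw [h3]
    exact lintegral_lintegral_swap
      (((hf.comp measurable_fst).mul hg).mul (hF.comp measurable_swap)).aemeasurable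
  have marg : ∀ F : α → ENNReal, Measurable F →
      ∫⁻ y, F y ∂(μ.map Y) = ∫⁻ y, Z y * F y ∂ν := by
    intro F hF
    have h := joint (fun z => F z.1) (by fun_prop)
    rw [lintegral_map (by fun_prop) (by fun_prop)] at h
    rw [lintegral_map hF hY, h]
    refine lintegral_congr fun y => ?_
    rw [← lintegral_mul_const _ (hhy y)]
  have hZfin : ∀ᵐ y ∂ν, Z y < ⊤ := by
    refine ae_lt_top hZm ?_
    have h := marg 1 measurable_one
    have : IsProbabilityMeasure (μ.map Y) := Measure.isProbabilityMeasure_map hY.aemeasurable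
    simp only [Pi.one_apply, mul_one, lintegral_one, measure_univ] at h
    simp [← h]
  set w : α → β → ENNReal := fun y x => (Z y)⁻¹ * (f x * g x y)
  have hw : Measurable (Function.uncurry w) := (hZm.comp measurable_fst).inv.mul hh
  set κ : Kernel α β := (Kernel.const α τ).withDensity w
  have hκ : ∀ y, κ y = (Z y)⁻¹ • τ.withDensity fun x => f x * g x y := by
    intro y
    rw [Kernel.withDensity_apply _ hw, Kernel.const_apply, ← withDensity_smul _ (hhy y)]
    rfl
  have : IsFiniteKernel κ := by
    -- `Z⁻¹ * Z ≤ 1` also when `Z` is `0` or `⊤`, so no exceptional set has to be removed.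
    refine ⟨1, ENNReal.one_lt_top, fun y => ?_⟩
    rw [hκ, Measure.smul_apply, withDensity_apply _ MeasurableSet.univ, Measure.restrict_univ]
    exact ENNReal.inv_mul_le_one _
  have key : condDistrib X Y μ =ᵐ[μ.map Y] κ := by
    refine condDistrib_ae_eq_of_measure_eq_compProd Y hX.aemeasurable ?_
    refine Measure.ext_of_lintegral _ fun F hF => ?_
    rw [joint F hF, Measure.lintegral_compProd hF,
      marg _ (hF.lintegral_kernel_prod_right')]
    refine lintegral_congr_ae ?_
    filter_upwards [hZfin] with y hy
    rw [hκ, lintegral_smul_measure, smul_eq_mul,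
      lintegral_withDensity_eq_lintegral_mul _ (hhy y) (by fun_prop), ← mul_assoc]
    simp only [Pi.mul_apply]
    -- Here `(Z y)⁻¹ = ⊤` cannot be cancelled, but the integrand vanishes `τ`-a.e.
    by_cases h0 : Z y = 0
    · have h0' := (lintegral_eq_zero_iff (hhy y)).1 h0
      rw [h0]
      simp only [zero_mul]
      rw [lintegral_eq_zero_iff (by fun_prop)]
      filter_upwards [h0'] with x hx
      simp only [Pi.zero_apply] at hx ⊢
      rw [hx, zero_mul]
    · rw [ENNReal.mul_inv_cancel h0 hy.ne, one_mul]
  filter_upwards [key] with y hy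
  rw [hy, hκ]

/-! ### Matrix densities and measurability. -/

section matrix

open Matrix

/-- Lebesgue measure on the space of `r × p` matrices. -/
noncomputable def matrixVolume (r p : ℕ) : Measure (Matrix (Fin r) (Fin p) ℝ) :=
  (volume : Measure (EuclideanSpace ℝ (Fin p × Fin r))).map fun x => Matrix.of fun i j => x (j, i)

theorem measurable_unvec (r p : ℕ) :
    Measurable fun x : EuclideanSpace ℝ (Fin p × Fin r) =>
      (Matrix.of fun i j => x (j, i) : Matrix (Fin r) (Fin p) ℝ) :=
  Continuous.measurable (continuous_matrix fun i j => by simp only [of_apply]; fun_prop)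

instance matrixVolume_sFinite (r p : ℕ) : SFinite (matrixVolume r p) := by
  unfold matrixVolume; infer_instance

instance symVolume_sFinite (p : ℕ) : SFinite (symVolume p) := by
  unfold symVolume; infer_instance

/-- The density of the matrix normal distribution with respect to `matrixVolume`. -/
noncomputable def matrixNormalPDF {r p : ℕ} (m : Matrix (Fin r) (Fin p) ℝ)
    (P : Matrix (Fin r) (Fin r) ℝ) (Sig : Matrix (Fin p) (Fin p) ℝ)
    (y : Matrix (Fin r) (Fin p) ℝ) : ℝ :=
  ((2 * Real.pi) ^ ((p * r : ℕ) / 2 : ℝ))⁻¹ * (√(Sig.det ^ r * P.det ^ p))⁻¹ *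
    Real.exp (-(1 / 2) * ((y - m)ᵀ * P⁻¹ * (y - m) * Sig⁻¹).trace)

/-- Inversion is the adjugate times the inverse determinant; this stays measurable across singular
matrices, where the inverse is `0`. -/
theorem measurable_matrix_inv (p : ℕ) :
    Measurable fun A : Matrix (Fin p) (Fin p) ℝ => A⁻¹ := by
  simp only [Matrix.inv_def, Ring.inverse_eq_inv']
  refine measurable_pi_lambda _ fun i => measurable_pi_lambda _ fun j => ?_
  have h1 : Measurable fun A : Matrix (Fin p) (Fin p) ℝ => A.det :=
    (continuous_id.matrix_det).measurable
  have h2 : Measurable fun A : Matrix (Fin p) (Fin p) ℝ => A.adjugate i j :=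
    ((continuous_id.matrix_adjugate).matrix_elem i j).measurable
  exact h1.inv.mul h2

instance matrixSecondCountable (r p : ℕ) :
    SecondCountableTopology (Matrix (Fin r) (Fin p) ℝ) :=
  inferInstanceAs (SecondCountableTopology (Fin r → Fin p → ℝ))

theorem measurable_trace_mul_inv {r p : ℕ} (B : Matrix (Fin r) (Fin p) ℝ → Matrix (Fin p) (Fin p) ℝ)
    (hB : Continuous B) :
    Measurable fun z : Matrix (Fin p) (Fin p) ℝ × Matrix (Fin r) (Fin p) ℝ =>
      (B z.2 * z.1⁻¹).trace := by
  have h : Continuous fun z : Matrix (Fin p) (Fin p) ℝ × Matrix (Fin p) (Fin p) ℝ =>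
      (z.1 * z.2).trace := (continuous_fst.matrix_mul continuous_snd).matrix_trace
  exact h.measurable.comp ((hB.measurable.comp measurable_snd).prodMk
    ((measurable_matrix_inv p).comp measurable_fst))

theorem measurable_matrixNormalPDF {r p : ℕ} (m : Matrix (Fin r) (Fin p) ℝ)
    (P : Matrix (Fin r) (Fin r) ℝ) :
    Measurable (Function.uncurry (matrixNormalPDF m P)) := by
  have h1 : Measurable fun A : Matrix (Fin p) (Fin p) ℝ => A.det :=
    (continuous_id.matrix_det).measurable
  have h2 := measurable_trace_mul_inv (fun y : Matrix (Fin r) (Fin p) ℝ => (y - m)ᵀ * P⁻¹ * (y - m))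
    ((((continuous_id.sub continuous_const).matrix_transpose.matrix_mul
      continuous_const).matrix_mul (continuous_id.sub continuous_const)))
  exact (measurable_const.mul ((((h1.comp measurable_fst).pow_const _).mul_const _).sqrt.inv)).mul
    (h2.const_mul _).exp

theorem measurable_miwWeight {p : ℕ} (S N : Matrix (Fin p) (Fin p) ℝ) (v : ℝ) :
    Measurable (miwWeight S N v) := by
  have h1 : Measurable fun A : Matrix (Fin p) (Fin p) ℝ => A.det :=
    (continuous_id.matrix_det).measurable
  have h2 := measurable_trace_mul_inv (r := p) (fun _ => diagSqrt N * S * diagSqrt N)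
    continuous_const
  exact (h1.pow_const _).mul
    ((h2.comp (measurable_id.prodMk measurable_id)).const_mul _).exp

theorem measurableSet_posDef (p : ℕ) :
    MeasurableSet {A : Matrix (Fin p) (Fin p) ℝ | A.PosDef} := by
  -- The semidefinite cone is closed, even as an uncountable intersection, and `det ≠ 0` is open.
  have h : {A : Matrix (Fin p) (Fin p) ℝ | A.PosDef} =
      ({A | Aᵀ = A} ∩ ⋂ x : Fin p → ℝ, {A | 0 ≤ x ⬝ᵥ A *ᵥ x}) ∩ {A | A.det ≠ 0} := by
    ext A
    have h : A.PosSemidef ↔ Aᵀ = A ∧ ∀ x : Fin p → ℝ, 0 ≤ x ⬝ᵥ A *ᵥ x := by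
      rw [posSemidef_iff_dotProduct_mulVec, IsHermitian, conjTranspose_eq_transpose_of_trivial]
      simp
    simp only [Set.mem_inter_iff, Set.mem_iInter, Set.mem_ofPred_eq, ← h]
    exact ⟨fun hA => ⟨hA.posSemidef, hA.det_pos.ne'⟩, fun hA => hA.1.posDef_iff_det_ne_zero.2 hA.2⟩
  rw [h]
  refine ((isClosed_eq continuous_id.matrix_transpose continuous_id).inter
    (isClosed_iInter fun x => ?_)).measurableSet.inter
    (isOpen_ne_fun continuous_id.matrix_det continuous_const).measurableSet
  exact isClosed_le continuous_const
    (continuous_const.dotProduct (continuous_id.matrix_mulVec continuous_const))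

theorem matrixNormal_eq_withDensity {r p : ℕ} (m : Matrix (Fin r) (Fin p) ℝ)
    {P : Matrix (Fin r) (Fin r) ℝ} (hP : P.PosDef) {Sig : Matrix (Fin p) (Fin p) ℝ}
    (hSig : Sig.PosDef) :
    matrixNormal m P Sig = (matrixVolume r p).withDensity fun y =>
      ENNReal.ofReal (matrixNormalPDF m P Sig y) := by
  rw [matrixNormal, multivariateGaussian_eq_withDensity _ (hSig.kronecker hP), matrixVolume,
    ← Measure.map_withDensity_comp _ (measurable_unvec r p)
      (measurable_matrixNormalPDF m P).of_uncurry_left.ennreal_ofReal]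
  congr 2
  ext x
  simp only [Function.comp, matrixNormalPDF, det_kronecker, Fintype.card_prod, Fintype.card_fin]
  congr 4
  set X : Matrix (Fin r) (Fin p) ℝ := (Matrix.of fun i j => x (j, i)) - m
  have hX : (x - WithLp.toLp 2 m.vec).ofLp = X.vec := by
    ext ij
    rfl
  have hinv : (Sig⁻¹)ᵀ = Sig⁻¹ :=
    (conjTranspose_eq_transpose_of_trivial _).symm.trans hSig.isHermitian.inv
  rw [hX, inv_kronecker, kronecker_mulVec_vec, vec_dotProduct_vec, hinv]
  simp only [Matrix.mul_assoc]

/-! ### The posterior scale and conjugacy. -/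

/-- The posterior scale matrix `S*`, i.e. `N*^{-1/2} B N*^{-1/2}` with
`B = (y - m)' P⁻¹ (y - m) + N^{1/2} S N^{1/2}`. -/
noncomputable def posteriorScale {r p : ℕ} (m : Matrix (Fin r) (Fin p) ℝ)
    (P : Matrix (Fin r) (Fin r) ℝ) (S N : Matrix (Fin p) (Fin p) ℝ)
    (y : Matrix (Fin r) (Fin p) ℝ) : Matrix (Fin p) (Fin p) ℝ :=
  (diagSqrt (N + (r : ℝ) • 1))⁻¹ * ((y - m)ᵀ * P⁻¹ * (y - m) + diagSqrt N * S * diagSqrt N) *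
    (diagSqrt (N + (r : ℝ) • 1))⁻¹

theorem isUnit_diagSqrt {p : ℕ} {N : Matrix (Fin p) (Fin p) ℝ} (hN : ∀ i, 0 < N i i) :
    IsUnit (diagSqrt N) := by
  rw [isUnit_iff_isUnit_det, diagSqrt, det_diagonal, isUnit_iff_ne_zero]
  exact Finset.prod_ne_zero_iff.2 fun i _ => (Real.sqrt_pos.2 (hN i)).ne'

theorem isHermitian_diagSqrt {p : ℕ} (N : Matrix (Fin p) (Fin p) ℝ) :
    (diagSqrt N)ᴴ = diagSqrt N := by
  simp [diagSqrt]

theorem Matrix.PosDef.mul_mul_self {p : ℕ} {B D : Matrix (Fin p) (Fin p) ℝ} (hB : B.PosDef)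
    (hD : IsUnit D) (hDH : Dᴴ = D) : (D * B * D).PosDef := by
  have h := hB.conjTranspose_mul_mul_same (B := D) (mulVec_injective_iff_isUnit.2 hD)
  rwa [hDH] at h

theorem posteriorScale_spec {r p : ℕ} {N : Matrix (Fin p) (Fin p) ℝ} (hN : ∀ i, 0 < N i i)
    (m : Matrix (Fin r) (Fin p) ℝ) (P : Matrix (Fin r) (Fin r) ℝ) (S : Matrix (Fin p) (Fin p) ℝ)
    (y : Matrix (Fin r) (Fin p) ℝ) (T : Matrix (Fin p) (Fin p) ℝ) :
    diagSqrt (N + (r : ℝ) • 1) * T * diagSqrt (N + (r : ℝ) • 1) =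
      (y - m)ᵀ * P⁻¹ * (y - m) + diagSqrt N * S * diagSqrt N ↔ T = posteriorScale m P S N y := by
  have hD : IsUnit (diagSqrt (N + (r : ℝ) • 1)).det :=
    (isUnit_iff_isUnit_det _).1 <| isUnit_diagSqrt fun i => by
      have := hN i
      simp only [Matrix.add_apply, Matrix.smul_apply, one_apply_eq, smul_eq_mul]
      positivity
  constructor
  · intro h
    rw [posteriorScale, ← h, Matrix.mul_assoc _ T, nonsing_inv_mul_cancel_left _ _ hD,
      mul_nonsing_inv_cancel_right _ _ hD]
  · rintro rfl
    rw [posteriorScale, Matrix.mul_assoc _⁻¹, mul_nonsing_inv_cancel_left _ _ hD,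
      nonsing_inv_mul_cancel_right _ _ hD]

theorem posDef_posteriorScale {r p : ℕ} {S N : Matrix (Fin p) (Fin p) ℝ}
    {P : Matrix (Fin r) (Fin r) ℝ} (hN : ∀ i, 0 < N i i) (hP : P.PosDef) (hS : S.PosDef)
    (m y : Matrix (Fin r) (Fin p) ℝ) : (posteriorScale m P S N y).PosDef := by
  have hD : IsUnit (diagSqrt (N + (r : ℝ) • 1)) := isUnit_diagSqrt fun i => by
      have := hN i
      simp only [Matrix.add_apply, Matrix.smul_apply, one_apply_eq, smul_eq_mul]
      positivity
  have h1 := hP.inv.posSemidef.conjTranspose_mul_mul_same (y - m)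
  rw [conjTranspose_eq_transpose_of_trivial] at h1
  refine ((hS.mul_mul_self (isUnit_diagSqrt hN) (isHermitian_diagSqrt N)).posSemidef_add
    h1).mul_mul_self ?_ ?_
  · exact (isUnit_nonsing_inv_iff).2 hD
  · rw [conjTranspose_nonsing_inv, isHermitian_diagSqrt]

/-- Conjugacy: prior weight times likelihood is a constant times the posterior weight. -/
theorem miwWeight_mul_matrixNormalPDF {r p : ℕ} (hp : 0 < p) {S N : Matrix (Fin p) (Fin p) ℝ}
    {P : Matrix (Fin r) (Fin r) ℝ} (hN : ∀ i, 0 < N i i) (m : Matrix (Fin r) (Fin p) ℝ) (v : ℝ)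
    (y : Matrix (Fin r) (Fin p) ℝ) {Sig : Matrix (Fin p) (Fin p) ℝ} (hSig : Sig.PosDef) :
    miwWeight S N v Sig * matrixNormalPDF m P Sig y =
      ((2 * Real.pi) ^ ((p * r : ℕ) / 2 : ℝ))⁻¹ * (√(P.det ^ p))⁻¹ *
        miwWeight (posteriorScale m P S N y) (N + (r : ℝ) • 1) v Sig := by
  have hd : 0 < Sig.det := hSig.det_pos
  have htr : (N + (r : ℝ) • 1).trace = N.trace + r * p := by simp [trace_add, trace_smul]
  have hexp : -(v + (N.trace + r * p) / (2 * (p : ℝ))) =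
      -(v + N.trace / (2 * (p : ℝ))) + -(r / 2 : ℝ) := by
    have : (p : ℝ) ≠ 0 := by positivity
    field_simp
    ring
  have hsqrt : (√(Sig.det ^ r * P.det ^ p))⁻¹ = Sig.det ^ (-(r / 2 : ℝ)) * (√(P.det ^ p))⁻¹ := by
    rw [Real.sqrt_mul (by positivity), mul_inv, Real.rpow_neg hd.le, Real.sqrt_eq_rpow,
      ← Real.rpow_natCast, ← Real.rpow_mul hd.le]
    congr 3
    ring
  rw [miwWeight, miwWeight, matrixNormalPDF, (posteriorScale_spec hN m P S y _).2 rfl, htr, hexp,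
    Real.rpow_add hd, hsqrt, Matrix.add_mul, trace_add, mul_add, Real.exp_add]
  ring

theorem miw_eq_withDensity {p : ℕ} (S N : Matrix (Fin p) (Fin p) ℝ) (v : ℝ) :
    miw S N v = (∫⁻ Sig, ENNReal.ofReal (miwWeight S N v Sig)
        ∂(symVolume p).restrict {Sig | Sig.PosDef})⁻¹ •
      ((symVolume p).restrict {Sig | Sig.PosDef}).withDensity
        fun Sig => ENNReal.ofReal (miwWeight S N v Sig) := by
  rw [miw, miwUnnormalized, withDensity_apply _ MeasurableSet.univ, Measure.restrict_univ]

/-- Normalization forgets constant factors, so the weights need only agree up to proportionality. -/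
theorem MeasureTheory.Measure.inv_lintegral_smul_withDensity_const_mul {α : Type*}
    [MeasurableSpace α] (τ : Measure α) {w : α → ENNReal} (hw : Measurable w) {K : ENNReal}
    (h0 : K ≠ 0) (htop : K ≠ ⊤) :
    (∫⁻ x, K * w x ∂τ)⁻¹ • τ.withDensity (fun x => K * w x) =
      (∫⁻ x, w x ∂τ)⁻¹ • τ.withDensity w := by
  rw [lintegral_const_mul _ hw, show (fun x => K * w x) = K • w from rfl, withDensity_smul _ hw,
    smul_smul, ENNReal.mul_inv (.inl h0) (.inl htop), mul_right_comm, ENNReal.inv_mul_cancel h0 htop,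
    one_mul]

end matrix

/-! ### The posterior law. -/

theorem proposition1 {Ω : Type*} [MeasurableSpace Ω] (μ : Measure Ω) [IsProbabilityMeasure μ]
    (r p : ℕ) (hp : 0 < p)
    (m : Matrix (Fin r) (Fin p) ℝ)
    (P : Matrix (Fin r) (Fin r) ℝ) (hP : P.PosDef)
    (S : Matrix (Fin p) (Fin p) ℝ) (hS : S.PosDef)
    (N : Matrix (Fin p) (Fin p) ℝ) (hN : N.IsDiag) (hNpos : ∀ i, 0 < N i i)
    (v : ℝ)
    (Y : Ω → Matrix (Fin r) (Fin p) ℝ) (hY : Measurable Y)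
    (Sig : Ω → Matrix (Fin p) (Fin p) ℝ) (hSig : Measurable Sig)
    (hSigLaw : μ.map Sig = miw S N v)
    (hYLaw : ∀ᵐ σ ∂(μ.map Sig), condDistrib Y Sig μ σ = matrixNormal m P σ) :
    ∃ Sstar : Matrix (Fin r) (Fin p) ℝ → Matrix (Fin p) (Fin p) ℝ,
      (∀ y, (Sstar y).PosDef) ∧
      (∀ y, ∀ T : Matrix (Fin p) (Fin p) ℝ,
        diagSqrt (N + (r : ℝ) • 1) * T * diagSqrt (N + (r : ℝ) • 1) =
          (y - m).transpose * P⁻¹ * (y - m) + diagSqrt N * S * diagSqrt N ↔ T = Sstar y) ∧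
      ∀ᵐ y ∂(μ.map Y), condDistrib Sig Y μ y = miw (Sstar y) (N + (r : ℝ) • 1) v := by
  refine ⟨posteriorScale m P S N, posDef_posteriorScale hNpos hP hS m,
    posteriorScale_spec hNpos m P S, ?_⟩
  set τ := (symVolume p).restrict {A : Matrix (Fin p) (Fin p) ℝ | A.PosDef} with hτ
  have hτpd : ∀ᵐ σ ∂τ, σ.PosDef := ae_restrict_mem (measurableSet_posDef p)
  set c : ENNReal := (∫⁻ σ, ENNReal.ofReal (miwWeight S N v σ) ∂τ)⁻¹ with hc
  have hw : ∀ S N : Matrix (Fin p) (Fin p) ℝ,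
      Measurable fun σ => ENNReal.ofReal (miwWeight S N v σ) :=
    fun S N => (measurable_miwWeight S N v).ennreal_ofReal
  have hlaw : μ.map Sig = τ.withDensity fun σ => c * ENNReal.ofReal (miwWeight S N v σ) := by
    rw [hSigLaw, miw_eq_withDensity, ← withDensity_smul _ (hw S N)]
    rfl
  -- Integrability of the prior weight follows from `Sig` having a law of mass one: were the
  -- integral `0` or `⊤`, this product would be `0`.
  have hcprod : c * ∫⁻ σ, ENNReal.ofReal (miwWeight S N v σ) ∂τ = 1 := by
    have : IsProbabilityMeasure (μ.map Sig) := Measure.isProbabilityMeasure_map hSig.aemeasurable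
    rw [← lintegral_const_mul _ (hw S N), ← measure_univ (μ := μ.map Sig), hlaw,
      withDensity_apply _ MeasurableSet.univ, Measure.restrict_univ]
  have hc0 : c ≠ 0 := left_ne_zero_of_mul_eq_one hcprod
  have hctop : c ≠ ⊤ := by
    intro h
    rw [hc, ENNReal.inv_eq_top] at h
    simp [h] at hcprod
  have hpdf : ∀ᵐ σ ∂(μ.map Sig), condDistrib Y Sig μ σ =
      (matrixVolume r p).withDensity fun y => ENNReal.ofReal (matrixNormalPDF m P σ y) := by
    have hpd : ∀ᵐ σ ∂(μ.map Sig), σ.PosDef :=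
      hlaw ▸ (withDensity_absolutelyContinuous τ _).ae_le hτpd
    filter_upwards [hYLaw, hpd] with σ hσ hσpd
    rw [hσ, matrixNormal_eq_withDensity m hP hσpd]
  have hbayes := condDistrib_ae_eq_of_withDensity μ hY hSig (matrixVolume r p) τ
    (f := fun σ => c * ENNReal.ofReal (miwWeight S N v σ))
    (g := fun σ y => ENNReal.ofReal (matrixNormalPDF m P σ y))
    (measurable_const.mul (hw S N)) (measurable_matrixNormalPDF m P).ennreal_ofReal hlaw hpdf
  have hk : 0 < ((2 * Real.pi) ^ ((p * r : ℕ) / 2 : ℝ))⁻¹ * (√(P.det ^ p))⁻¹ := by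
    have := hP.det_pos
    positivity
  set k := ((2 * Real.pi) ^ ((p * r : ℕ) / 2 : ℝ))⁻¹ * (√(P.det ^ p))⁻¹ with hkdef
  filter_upwards [hbayes] with y hy
  have hae : (fun σ => c * ENNReal.ofReal (miwWeight S N v σ) *
      ENNReal.ofReal (matrixNormalPDF m P σ y)) =ᵐ[τ] fun σ => c * ENNReal.ofReal k *
        ENNReal.ofReal (miwWeight (posteriorScale m P S N y) (N + (r : ℝ) • 1) v σ) := by
    filter_upwards [hτpd] with σ hσ
    have hpos : 0 ≤ miwWeight S N v σ :=
      mul_nonneg (Real.rpow_nonneg hσ.det_pos.le _) (Real.exp_nonneg _)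
    rw [mul_assoc, mul_assoc, ← ENNReal.ofReal_mul hpos, ← ENNReal.ofReal_mul hk.le,
      miwWeight_mul_matrixNormalPDF hp hNpos m v y hσ]
  -- Both sides carry the same inverse integral, so finiteness of the posterior normalizer is not
  -- needed.
  rw [hy, lintegral_congr_ae hae, withDensity_congr_ae hae,
    Measure.inv_lintegral_smul_withDensity_const_mul τ (hw _ _)
      (mul_ne_zero hc0 (by simpa using hk)) (ENNReal.mul_ne_top hctop ENNReal.ofReal_ne_top),
    miw_eq_withDensity]
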